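/- Let $E$ be a finite set and $\mathcal L\subseteq 2^E$. For $e\in E$ the toggle $t_e:\mathcal L\to\mathcal L$ is given by $t_e(X)=X\cup\{e\}$ if $e\notin X$ and $X\cup\{e\}\in\mathcal L$, by $t_e(X)=X\setminus\{e\}$ if $e\in X$ and $X\setminus\{e\}\in\mathcal L$, and by $t_e(X)=X$ otherwise. Each $t_e$ is an involution, and the toggle group $T(\mathcal L)$ is the subgroup of the symmetric group $\mathfrak S_{\mathcal L}$ generated by $\{t_e\mid e\in E\}$. The family $\mathcal L$ is called toggle-alternating if $T(\mathcal L)$ contains the alternating group $A_{\mathcal L}$. The ordinal sum $P_1\oplus P_2$ of two posets is the poset on the disjoint union of $P_1$ and $P_2$ which keeps the orders of $P_1$ and $P_2$ and in which every element of $P_1$ is less than every element of $P_2$. Let $P$ be a finite poset and let $\mathcal C(P)\subseteq 2^P$ be the family of its chains, that is, of its sets of mutually comparable elements (including $\emptyset$). 1. If $P=P_1\oplus P_2$, then $T(\mathcal C(P))=T(\mathcal C(P_1))\times T(\mathcal C(P_2))$; precisely, $(C_1,C_2)\mapsto C_1\cup C_2$ is a bijection $\mathcal C(P_1)\times\mathcal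 C(P_2)\to\mathcal C(P)$, and there is a group isomorphism $T(\mathcal C(P))\to T(\mathcal C(P_1))\times T(\mathcal C(P_2))$, $g\mapsto(g_1,g_2)$, such that $g(C_1\cup C_2)=g_1(C_1)\cup g_2(C_2)$ for all $g\in T(\mathcal C(P))$, $C_1\in\mathcal C(P_1)$ and $C_2\in\mathcal C(P_2)$. 2. If $P$ is not the ordinal sum of two nonempty posets, then $\mathcal C(P)$ is toggle-alternating. -/

import Mathlib

namespace ToggleGroups

universe u

open Classical in
/-- The toggle `t_e : L → L` of an element `e` of the ground set, as a function. -/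
noncomputable def toggleFun {E : Type u} (L : Set (Set E)) (e : E) (X : L) : L :=
  if h : e ∉ X.1 ∧ X.1 ∪ {e} ∈ L then ⟨X.1 ∪ {e}, h.2⟩
  else if h : e ∈ X.1 ∧ X.1 \ {e} ∈ L then ⟨X.1 \ {e}, h.2⟩
  else X

theorem toggleFun_involutive {E : Type u} (L : Set (Set E)) (e : E) :
    Function.Involutive (toggleFun L e) := by
  rintro ⟨X, hX⟩
  by_cases he : e ∈ X
  · by_cases h : X \ {e} ∈ L
    · simp [toggleFun, he, h, hX]
    · simp [toggleFun, he, h]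
  · by_cases h : insert e X ∈ L
    · simp [toggleFun, he, h, hX]
    · simp [toggleFun, he, h]

/-- The toggle `t_e` as an element of the symmetric group on `L`. -/
noncomputable def toggle {E : Type u} (L : Set (Set E)) (e : E) : Equiv.Perm L :=
  (toggleFun_involutive L e).toPerm

/-- The toggle group `T(L)`: the subgroup of the symmetric group on `L` generated by all toggles. -/
def toggleGroup {E : Type u} (L : Set (Set E)) : Subgroup (Equiv.Perm L) :=
  Subgroup.closure (Set.range (toggle L))

open Classical in
/-- `L` is toggle-alternating if `T(L)` contains the alternating group on `L`. -/
def ToggleAlternating {E : Type u} [Finite E] (L : Set (Set E)) : Prop :=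
  letI : Fintype L := Fintype.ofFinite L
  alternatingGroup L ≤ toggleGroup L

/-- The family of all chains (sets of mutually comparable elements) of a poset. -/
def chains (P : Type u) [PartialOrder P] : Set (Set P) :=
  {C | IsChain (· ≤ ·) C}

/-- `P` is an ordinal sum of two nonempty posets. The lexicographic sum `P₁ ⊕ₗ P₂` is the ordinal
sum: every element of `P₁` is below every element of `P₂`. -/
def IsOrdinalSum (P : Type u) [PartialOrder P] : Prop :=
  ∃ (P₁ P₂ : Type u) (_ : PartialOrder P₁) (_ : PartialOrder P₂),
    Nonempty P₁ ∧ Nonempty P₂ ∧ Nonempty (P ≃o P₁ ⊕ₗ P₂)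

end ToggleGroups

/-!
The chains of `P` are the independent sets of its incomparability graph, which is connected unless
`P` is an ordinal sum. So let `G` be a connected graph and let `v` be a vertex whose deletion keeps
it connected. The independent sets avoiding `v` are more than half of all independent sets, because
removing `v` is injective on those containing `v` and misses every set containing a neighbour of
`v`. This has two consequences, both by induction on the number of vertices.

* The toggle group of `G` is primitive, since that of `G - v` is and it acts on more than half of
  the points.
* If the toggle group of `G - v` contains the alternating group on its `n ≥ 5` points, then the even
  permutations of these points lift to the toggle group of `G`. Fewer than `n` points remain, too
  few for a nontrivial action of the simple group `A_n`, so by Goursat's lemma the lifts can be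
  chosen to fix them. In particular there is a 3-cycle, and Jordan's theorem applies.

If a neighbour of `v` is adjacent to all other vertices, then the toggle of that neighbour is a
transposition, and Jordan's theorem applies directly. Otherwise `G - v` has at least three vertices,
two of them nonadjacent, hence at least five independent sets.
-/

namespace ToggleGroups

open MulAction

section PermutationGroups

/-- If `N` is the kernel of `K → Q`, seen in `A`, then `N` is normal in the simple group `A`, and
`N = ⊥` would embed `A` into `Q`. -/
theorem goursatFst_eq_top_of_card_lt {A Q : Type*} [Group A] [Group Q] [IsSimpleGroup A] [Finite Q]
    {K : Subgroup (A × Q)} (hK : Function.Surjective (Prod.fst ∘ K.subtype))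
    (hcard : Nat.card Q < Nat.card A) : K.goursatFst = ⊤ := by
  refine (Subgroup.normal_goursatFst hK).eq_bot_or_eq_top.resolve_left fun hbot => ?_
  choose lift hlift using hK
  have hinj : Function.Injective fun a => (lift a).1.2 := by
    intro a b hab
    have hmem : a * b⁻¹ ∈ K.goursatFst := by
      rw [Subgroup.mem_goursatFst]
      convert K.mul_mem (lift a).2 (K.inv_mem (lift b).2) using 1
      refine Prod.ext ?_ (mul_inv_eq_one.2 hab).symm
      exact (congrArg₂ (· * ·⁻¹) (hlift a) (hlift b)).symm
    exact mul_inv_eq_one.1 (Subgroup.mem_bot.1 (hbot ▸ hmem))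
  exact (Nat.card_le_card_of_injective _ hinj).not_gt hcard

variable {α β γ : Type*}

theorem card_perm_lt_card_alternatingGroup [Finite γ] [Fintype β] [DecidableEq β]
    (hβ : 3 ≤ Nat.card β) (hγβ : Nat.card γ < Nat.card β) :
    Nat.card (Equiv.Perm γ) < Nat.card (alternatingGroup β) := by
  have : Nontrivial β := (Finite.one_lt_card_iff_nontrivial).1 (by lia)
  have htwo := two_mul_nat_card_alternatingGroup (α := β)
  obtain ⟨n, hn⟩ := Nat.exists_eq_add_one_of_ne_zero (by lia : Nat.card β ≠ 0)
  rw [Nat.card_perm, hn, Nat.factorial_succ] at htwo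
  have hthree : 3 * n.factorial ≤ (n + 1) * n.factorial := Nat.mul_le_mul_right _ (hn ▸ hβ)
  calc Nat.card (Equiv.Perm γ) = (Nat.card γ).factorial := Nat.card_perm
    _ ≤ n.factorial := Nat.factorial_le (by lia)
    _ < Nat.card (alternatingGroup β) := by have := n.factorial_pos; lia

open Classical in
/-- The permutation of `α` glued from a permutation of a subset (the range of `ι`) and a permutation
of its complement. -/
noncomputable def glueHom (ι : β ↪ α) :
    Equiv.Perm β × Equiv.Perm {x // x ∉ Set.range ι} →* Equiv.Perm α :=
  (Equiv.Perm.subtypeCongrHom (· ∈ Set.range ι)).comp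
    ((Equiv.ofInjective ι ι.injective).permCongrHom.toMonoidHom.prodMap (MonoidHom.id _))

theorem glueHom_one_right (ι : β ↪ α) (σ : Equiv.Perm β) :
    glueHom ι (σ, 1) = σ.viaEmbedding ι :=
  rfl

theorem exists_glueHom_eq {ι : β ↪ α} {σ : Equiv.Perm β} {g : Equiv.Perm α}
    (hg : Function.Semiconj ι σ g) : ∃ τ, glueHom ι (σ, τ) = g := by
  have hrange : ∀ x, g x ∉ Set.range ι ↔ x ∉ Set.range ι := by
    refine fun x => not_congr ⟨?_, ?_⟩
    · rintro ⟨y, hy⟩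
      exact ⟨σ.symm y, g.injective (by rw [← hg, σ.apply_symm_apply, hy])⟩
    · rintro ⟨y, rfl⟩
      exact ⟨σ y, hg y⟩
  classical
  refine ⟨g.subtypePerm hrange, Equiv.ext fun x => ?_⟩
  by_cases hx : x ∈ Set.range ι
  · obtain ⟨y, rfl⟩ := hx
    simp [glueHom, Equiv.Perm.subtypeCongr.left_apply, Equiv.permCongrHom, hg.eq]
  · simp [glueHom, Equiv.Perm.subtypeCongr.right_apply _ _ hx]

theorem viaEmbedding_mem_of_semiconj [Finite α] [Fintype β] [DecidableEq β] {ι : β ↪ α}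
    {H : Subgroup (Equiv.Perm α)} (hβ : 5 ≤ Nat.card β) (hαβ : Nat.card α < 2 * Nat.card β)
    (hlift : ∀ σ ∈ alternatingGroup β, ∃ g ∈ H, Function.Semiconj ι σ g)
    {σ : Equiv.Perm β} (hσ : σ ∈ alternatingGroup β) : σ.viaEmbedding ι ∈ H := by
  let K : Subgroup (alternatingGroup β × Equiv.Perm {x // x ∉ Set.range ι}) :=
    H.comap ((glueHom ι).comp ((alternatingGroup β).subtype.prodMap (MonoidHom.id _)))
  have hsurj : Function.Surjective (Prod.fst ∘ K.subtype) := by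
    rintro ⟨τ, hτ⟩
    obtain ⟨g, hgH, hg⟩ := hlift τ hτ
    obtain ⟨ρ, rfl⟩ := exists_glueHom_eq hg
    exact ⟨⟨(⟨τ, hτ⟩, ρ), hgH⟩, rfl⟩
  have hcompl : Nat.card {x // x ∉ Set.range ι} < Nat.card β := by
    have hadd := Set.ncard_add_ncard_compl (Set.range ι)
    rw [Set.ncard_range_of_injective ι.injective, ← Nat.card_coe_set_eq] at hadd
    change Nat.card ↥(Set.range ι)ᶜ < _
    lia
  have : IsSimpleGroup (alternatingGroup β) := alternatingGroup.isSimpleGroup hβ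
  have htop := goursatFst_eq_top_of_card_lt hsurj
    (card_perm_lt_card_alternatingGroup (by lia) hcompl)
  rw [← glueHom_one_right]
  exact Subgroup.mem_goursatFst.1 (htop ▸ Subgroup.mem_top (⟨σ, hσ⟩ : alternatingGroup β))

theorem alternatingGroup_le_of_isPreprimitive_of_semiconj [Fintype α] [DecidableEq α] [Fintype β]
    [DecidableEq β] {ι : β ↪ α} {H : Subgroup (Equiv.Perm α)} [IsPreprimitive H α]
    (hβ : 5 ≤ Nat.card β) (hαβ : Nat.card α < 2 * Nat.card β)
    (hlift : ∀ σ ∈ alternatingGroup β, ∃ g ∈ H, Function.Semiconj ι σ g) :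
    alternatingGroup α ≤ H := by
  obtain ⟨a, b, c, hab, hac, hbc⟩ := Fintype.two_lt_card_iff.1
    (by rw [← Nat.card_eq_fintype_card]; lia : 2 < Fintype.card β)
  have hcycle := Equiv.Perm.isThreeCycle_swap_mul_swap_same hab hac hbc
  have hvia : (Equiv.Perm.viaEmbedding (Equiv.swap a b * Equiv.swap a c) ι).IsThreeCycle := by
    rw [Equiv.Perm.IsThreeCycle] at hcycle ⊢
    rw [Equiv.Perm.viaEmbedding, ← hcycle]
    convert! Equiv.Perm.cycleType_extendDomain _
  exact Equiv.Perm.alternatingGroup_le_of_isPreprimitive_of_isThreeCycle_mem inferInstance hvia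
    (viaEmbedding_mem_of_semiconj hβ hαβ hlift hcycle.mem_alternatingGroup)

end PermutationGroups

section Toggles

open scoped symmDiff

variable {E E' : Type*} {L : Set (Set E)} {L' : Set (Set E')}

theorem toggle_mem_toggleGroup (L : Set (Set E)) (e : E) : toggle L e ∈ toggleGroup L :=
  Subgroup.subset_closure ⟨e, rfl⟩

theorem symmDiff_singleton_of_mem {e : E} {X : Set E} (he : e ∈ X) : X ∆ {e} = X \ {e} := by
  ext x
  simp only [Set.mem_symmDiff, Set.mem_singleton_iff, Set.mem_sdiff]
  grind

theorem symmDiff_singleton_of_notMem {e : E} {X : Set E} (he : e ∉ X) : X ∆ {e} = X ∪ {e} :=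
  (Set.disjoint_singleton_right.2 he).symmDiff_eq_sup

theorem toggle_apply_of_mem {e : E} {X : L} (h : X.1 ∆ {e} ∈ L) :
    toggle L e X = ⟨X.1 ∆ {e}, h⟩ := by
  refine Subtype.ext ?_
  by_cases he : e ∈ X.1
  · rw [symmDiff_singleton_of_mem he] at h
    simp [toggle, toggleFun, he, h, symmDiff_singleton_of_mem]
  · rw [symmDiff_singleton_of_notMem he] at h
    simp only [toggle, toggleFun, Function.Involutive.coe_toPerm, dif_pos (And.intro he h),
      symmDiff_singleton_of_notMem he]

theorem toggle_apply_of_notMem {e : E} {X : L} (h : X.1 ∆ {e} ∉ L) : toggle L e X = X := by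
  by_cases he : e ∈ X.1
  · rw [symmDiff_singleton_of_mem he] at h
    simp [toggle, toggleFun, he, h]
  · rw [symmDiff_singleton_of_notMem he] at h
    simp only [toggle, toggleFun, Function.Involutive.coe_toPerm, he, h, not_false_eq_true,
      and_false, false_and, dite_false]

theorem semiconj_toggle_of_image_union {j : E' → E} (hj : Function.Injective j) {Y : Set E}
    (hY : Disjoint (Set.range j) Y) (hL : ∀ Z, j '' Z ∪ Y ∈ L ↔ Z ∈ L') {f : L' → L}
    (hf : ∀ X, (f X).1 = j '' X.1 ∪ Y) (e : E') :
    Function.Semiconj f (toggle L' e) (toggle L (j e)) := by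
  intro X
  have hsymmDiff : (f X).1 ∆ {j e} = j '' (X.1 ∆ {e}) ∪ Y := by
    have hdisj : ∀ Z : Set E', j '' Z ∪ Y = (j '' Z) ∆ Y := fun Z =>
      (hY.mono_left (Set.image_subset_range j Z)).symmDiff_eq_sup.symm
    rw [hf, hdisj, hdisj, Set.image_symmDiff hj, Set.image_singleton, symmDiff_right_comm]
  by_cases h : X.1 ∆ {e} ∈ L'
  · have h' : (f X).1 ∆ {j e} ∈ L := by rwa [hsymmDiff, hL]
    rw [toggle_apply_of_mem h, toggle_apply_of_mem h']
    exact Subtype.ext ((hf _).trans hsymmDiff.symm)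
  · have h' : (f X).1 ∆ {j e} ∉ L := by rwa [hsymmDiff, hL]
    rw [toggle_apply_of_notMem h, toggle_apply_of_notMem h']

theorem exists_mem_toggleGroup_semiconj {f : L' → L} {j : E' → E}
    (hf : ∀ e, Function.Semiconj f (toggle L' e) (toggle L (j e))) {σ : Equiv.Perm L'}
    (hσ : σ ∈ toggleGroup L') : ∃ g ∈ toggleGroup L, Function.Semiconj f σ g := by
  induction hσ using Subgroup.closure_induction with
  | mem x hx =>
    obtain ⟨e, rfl⟩ := hx
    exact ⟨toggle L (j e), toggle_mem_toggleGroup L (j e), hf e⟩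
  | one => exact ⟨1, one_mem _, Function.Semiconj.id_right⟩
  | mul x y _ _ hx hy =>
    obtain ⟨g, hg, hxg⟩ := hx
    obtain ⟨h, hh, hyh⟩ := hy
    exact ⟨g * h, mul_mem hg hh, hxg.comp_right hyh⟩
  | inv x _ hx =>
    obtain ⟨g, hg, hxg⟩ := hx
    exact ⟨g⁻¹, inv_mem hg, hxg.inverses_right x.right_inv g.left_inv⟩

theorem isPreprimitive_toggleGroup_of_semiconj [Finite L] [IsPretransitive (toggleGroup L) L]
    [IsPreprimitive (toggleGroup L') L'] {f : L' → L} {j : E' → E} (hfinj : Function.Injective f)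
    (hf : ∀ e, Function.Semiconj f (toggle L' e) (toggle L (j e)))
    (hcard : Nat.card L < 2 * Nat.card L') : IsPreprimitive (toggleGroup L) L := by
  choose lift hlift hsemiconj using fun σ : toggleGroup L' => exists_mem_toggleGroup_semiconj hf σ.2
  let F : L' →ₑ[fun σ => (⟨lift σ, hlift σ⟩ : toggleGroup L)] L := ⟨f, fun σ => hsemiconj σ⟩
  refine IsPreprimitive.of_card_lt (f := F) ?_
  rwa [show ⇑F = f from rfl, Set.ncard_range_of_injective hfinj]

theorem exists_apply_empty_eq (hL : IsLowerSet L) (hempty : ∅ ∈ L) {X : Set E} (hfin : X.Finite)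
    (hX : X ∈ L) : ∃ g ∈ toggleGroup L, g ⟨∅, hempty⟩ = ⟨X, hX⟩ := by
  induction X, hfin using Set.Finite.induction_on with
  | empty => exact ⟨1, one_mem _, rfl⟩
  | @insert a S ha _ ih =>
    obtain ⟨g, hg, hgS⟩ := ih (hL (Set.subset_insert a S) hX)
    have hinsert : S ∆ {a} = insert a S := by
      rw [symmDiff_singleton_of_notMem ha, Set.union_singleton]
    refine ⟨toggle L a * g, mul_mem (toggle_mem_toggleGroup L a) hg, ?_⟩
    rw [Equiv.Perm.mul_apply, hgS, toggle_apply_of_mem (by rwa [hinsert])]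
    exact Subtype.ext hinsert

theorem isPretransitive_toggleGroup (hL : IsLowerSet L) (hfin : ∀ X ∈ L, X.Finite) :
    IsPretransitive (toggleGroup L) L := by
  refine ⟨fun X Y => ?_⟩
  have hempty : ∅ ∈ L := hL (Set.empty_subset X.1) X.2
  obtain ⟨g, hg, hgX⟩ := exists_apply_empty_eq hL hempty (hfin _ X.2) X.2
  obtain ⟨h, hh, hhY⟩ := exists_apply_empty_eq hL hempty (hfin _ Y.2) Y.2
  refine ⟨⟨h * g⁻¹, mul_mem hh (inv_mem hg)⟩, ?_⟩
  rw [Subgroup.mk_smul, Equiv.Perm.smul_def, Equiv.Perm.mul_apply,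
    Equiv.Perm.inv_eq_iff_eq.2 hgX.symm, hhY]

theorem ToggleAlternating.of_toggleGroup_eq_top [Finite E] (hL : toggleGroup L = ⊤) :
    ToggleAlternating L := by
  rw [ToggleAlternating, hL]
  exact le_top

end Toggles

section DirectSums

variable {α β γ E E₁ E₂ : Type*} {L : Set (Set E)} {L₁ : Set (Set E₁)} {L₂ : Set (Set E₂)}

/-- Pairs of permutations acting componentwise on a type identified with a product. -/
def permProdHom (b : α × β ≃ γ) : Equiv.Perm α × Equiv.Perm β →* Equiv.Perm γ where
  toFun g := b.permCongr (Equiv.prodCongr g.1 g.2)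
  map_one' := by ext; simp
  map_mul' g h := by ext; simp [Prod.map]

theorem permProdHom_apply (b : α × β ≃ γ) (g : Equiv.Perm α × Equiv.Perm β) (x : α × β) :
    permProdHom b g (b x) = b (g.1 x.1, g.2 x.2) := by
  simp [permProdHom, Prod.map]

theorem permProdHom_injective [Nonempty α] [Nonempty β] (b : α × β ≃ γ) :
    Function.Injective (permProdHom b) := by
  intro g h hgh
  have hpair : ∀ x y, (g.1 x, g.2 y) = (h.1 x, h.2 y) := fun x y =>
    b.injective (by rw [← permProdHom_apply b g (x, y), hgh, permProdHom_apply])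
  exact Prod.ext (Equiv.ext fun x => congrArg Prod.fst (hpair x (Classical.arbitrary β)))
    (Equiv.ext fun y => congrArg Prod.snd (hpair (Classical.arbitrary α) y))

theorem disjoint_range_inl_range_inr (e : E₁ ⊕ E₂ ≃ E) :
    Disjoint (Set.range (e ∘ Sum.inl)) (Set.range (e ∘ Sum.inr)) := by
  rw [Set.range_comp, Set.range_comp, Set.disjoint_image_iff e.injective]
  exact Set.isCompl_range_inl_range_inr.disjoint

/-- Subsets of a disjoint union as pairs of subsets of its two parts. -/
def unionEquiv (e : E₁ ⊕ E₂ ≃ E) : Set E₁ × Set E₂ ≃ Set E :=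
  Set.sumEquiv.symm.toEquiv.trans (Equiv.Set.congr e)

theorem unionEquiv_apply (e : E₁ ⊕ E₂ ≃ E) (X : Set E₁ × Set E₂) :
    unionEquiv e X = (e ∘ Sum.inl) '' X.1 ∪ (e ∘ Sum.inr) '' X.2 := by
  rw [Set.image_comp, Set.image_comp, ← Set.image_union]
  rfl

/-- The family `L` is the direct sum of `L₁` and `L₂` along a splitting `e` of its ground set: its
members are the unions of a member of `L₁` and a member of `L₂`. -/
def IsDirectSum (e : E₁ ⊕ E₂ ≃ E) (L₁ : Set (Set E₁)) (L₂ : Set (Set E₂)) (L : Set (Set E)) :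
    Prop :=
  ∀ X, unionEquiv e X ∈ L ↔ X.1 ∈ L₁ ∧ X.2 ∈ L₂

namespace IsDirectSum

variable {e : E₁ ⊕ E₂ ≃ E}

/-- Pairs of members of the summands as members of the direct sum. -/
def prodEquiv (h : IsDirectSum e L₁ L₂ L) : L₁ × L₂ ≃ L :=
  (Equiv.Set.prod L₁ L₂).symm.trans ((unionEquiv e).subtypeEquiv fun X => (h X).symm)

theorem coe_prodEquiv (h : IsDirectSum e L₁ L₂ L) (X : L₁ × L₂) :
    (h.prodEquiv X).1 = (e ∘ Sum.inl) '' X.1.1 ∪ (e ∘ Sum.inr) '' X.2.1 :=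
  unionEquiv_apply e (X.1.1, X.2.1)

theorem permProdHom_toggle_left (h : IsDirectSum e L₁ L₂ L) (x : E₁) :
    permProdHom h.prodEquiv (toggle L₁ x, 1) = toggle L (e (Sum.inl x)) := by
  refine Equiv.ext (h.prodEquiv.surjective.forall.2 fun X => ?_)
  rw [permProdHom_apply]
  refine semiconj_toggle_of_image_union (Y := (e ∘ Sum.inr) '' X.2.1)
    (f := fun X₁ => h.prodEquiv (X₁, X.2)) (e.injective.comp Sum.inl_injective)
    ((disjoint_range_inl_range_inr e).mono_right (Set.image_subset_range _ _)) (fun Z => ?_)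
    (fun X₁ => h.coe_prodEquiv (X₁, X.2)) x X.1
  rw [← unionEquiv_apply e (Z, X.2.1), h]
  exact and_iff_left X.2.2

theorem permProdHom_toggle_right (h : IsDirectSum e L₁ L₂ L) (x : E₂) :
    permProdHom h.prodEquiv (1, toggle L₂ x) = toggle L (e (Sum.inr x)) := by
  refine Equiv.ext (h.prodEquiv.surjective.forall.2 fun X => ?_)
  rw [permProdHom_apply]
  refine semiconj_toggle_of_image_union (Y := (e ∘ Sum.inl) '' X.1.1)
    (f := fun X₂ => h.prodEquiv (X.1, X₂)) (e.injective.comp Sum.inr_injective)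
    ((disjoint_range_inl_range_inr e).symm.mono_right (Set.image_subset_range _ _)) (fun Z => ?_)
    (fun X₂ => (h.coe_prodEquiv (X.1, X₂)).trans (Set.union_comm _ _)) x X.2
  rw [Set.union_comm, ← unionEquiv_apply e (X.1.1, Z), h]
  exact and_iff_right X.1.2

theorem map_permProdHom (h : IsDirectSum e L₁ L₂ L) :
    ((toggleGroup L₁).prod (toggleGroup L₂)).map (permProdHom h.prodEquiv) = toggleGroup L := by
  refine le_antisymm ?_ ?_
  · rw [Subgroup.map_le_iff_le_comap, Subgroup.prod_le_iff, Subgroup.map_le_iff_le_comap,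
      Subgroup.map_le_iff_le_comap]
    refine ⟨(Subgroup.closure_le _).2 ?_, (Subgroup.closure_le _).2 ?_⟩
    · rintro _ ⟨x, rfl⟩
      change permProdHom h.prodEquiv (toggle L₁ x, 1) ∈ toggleGroup L
      rw [h.permProdHom_toggle_left]
      exact toggle_mem_toggleGroup L _
    · rintro _ ⟨x, rfl⟩
      change permProdHom h.prodEquiv (1, toggle L₂ x) ∈ toggleGroup L
      rw [h.permProdHom_toggle_right]
      exact toggle_mem_toggleGroup L _
  · refine (Subgroup.closure_le _).2 (Set.range_subset_iff.2 (e.surjective.forall.2 ?_))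
    rintro (x | x)
    · exact ⟨(toggle L₁ x, 1), ⟨toggle_mem_toggleGroup L₁ x, one_mem _⟩,
        h.permProdHom_toggle_left x⟩
    · exact ⟨(1, toggle L₂ x), ⟨one_mem _, toggle_mem_toggleGroup L₂ x⟩,
        h.permProdHom_toggle_right x⟩

/-- The toggle group of a direct sum of nonempty families is the product of the toggle groups. -/
noncomputable def toggleGroupProdEquiv [Nonempty L₁] [Nonempty L₂] (h : IsDirectSum e L₁ L₂ L) :
    toggleGroup L₁ × toggleGroup L₂ ≃* toggleGroup L :=
  (Subgroup.prodEquiv _ _).symm.trans <|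
    (Subgroup.equivMapOfInjective _ _ (permProdHom_injective h.prodEquiv)).trans
      (MulEquiv.subgroupCongr h.map_permProdHom)

theorem toggleGroupProdEquiv_apply [Nonempty L₁] [Nonempty L₂] (h : IsDirectSum e L₁ L₂ L)
    (g : toggleGroup L₁ × toggleGroup L₂) (X : L₁ × L₂) :
    (h.toggleGroupProdEquiv g).1 (h.prodEquiv X) = h.prodEquiv (g.1.1 X.1, g.2.1 X.2) :=
  permProdHom_apply h.prodEquiv (g.1.1, g.2.1) X

end IsDirectSum

end DirectSums

section IndependentSets

open scoped symmDiff

universe u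

variable {V : Type*} {G : SimpleGraph V}

/-- The family of independent sets of a graph. -/
def indepSets (G : SimpleGraph V) : Set (Set V) :=
  {X | G.IsIndepSet X}

theorem isLowerSet_indepSets (G : SimpleGraph V) : IsLowerSet (indepSets G) :=
  fun _ _ hYX hX => Set.Pairwise.mono hYX hX

theorem mem_indepSets_of_subsingleton (G : SimpleGraph V) {X : Set V} (hX : X.Subsingleton) :
    X ∈ indepSets G :=
  hX.pairwise _

theorem pair_mem_indepSets {a b : V} (hab : ¬ G.Adj a b) : {a, b} ∈ indepSets G :=
  Set.pairwise_pair.2 fun _ => ⟨hab, fun h => hab h.symm⟩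

theorem isPretransitive_toggleGroup_indepSets [Finite V] (G : SimpleGraph V) :
    IsPretransitive (toggleGroup (indepSets G)) (indepSets G) :=
  isPretransitive_toggleGroup (isLowerSet_indepSets G) fun X _ => X.toFinite

theorem image_val_mem_indepSets_iff {s : Set V} {Z : Set s} :
    Subtype.val '' Z ∈ indepSets G ↔ Z ∈ indepSets (G.induce s) :=
  Subtype.val_injective.injOn.pairwise_image

/-- An independent set of an induced subgraph, seen as an independent set of the graph. -/
def indepSetsEmbedding (G : SimpleGraph V) (s : Set V) :
    indepSets (G.induce s) ↪ indepSets G where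
  toFun X := ⟨Subtype.val '' X.1, image_val_mem_indepSets_iff.2 X.2⟩
  inj' _ _ h := Subtype.ext (Subtype.val_injective.image_injective (congrArg Subtype.val h))

theorem semiconj_indepSetsEmbedding_toggle (G : SimpleGraph V) (s : Set V) (x : s) :
    Function.Semiconj (indepSetsEmbedding G s) (toggle _ x) (toggle _ x.1) :=
  semiconj_toggle_of_image_union (Y := ∅) Subtype.val_injective (Set.disjoint_empty _)
    (fun Z => by rw [Set.union_empty, image_val_mem_indepSets_iff])
    (fun _ => (Set.union_empty _).symm) x

theorem card_indepSets_lt [Finite V] {v a : V} (hva : G.Adj v a) :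
    Nat.card (indepSets G) < 2 * Nat.card (indepSets (G.induce {v}ᶜ)) := by
  classical
  let f : indepSets G → Bool × indepSets (G.induce {v}ᶜ) := fun X =>
    (decide (v ∈ X.1), ⟨Subtype.val ⁻¹' X.1, image_val_mem_indepSets_iff.1
      (isLowerSet_indepSets G (Set.image_preimage_subset _ _) X.2)⟩)
  have hf : Function.Injective f := by
    intro X Y h
    simp only [f, Prod.mk.injEq, decide_eq_decide, Subtype.mk.injEq] at h
    ext x
    by_cases hx : x = v
    · rw [hx, h.1]
    · exact Set.ext_iff.1 h.2 ⟨x, hx⟩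
  let a' : ({v}ᶜ : Set V) := ⟨a, hva.ne'⟩
  have hmissed : (true, ⟨{a'}, mem_indepSets_of_subsingleton _ Set.subsingleton_singleton⟩) ∉
      Set.range f := by
    rintro ⟨X, hX⟩
    simp only [f, Prod.mk.injEq, decide_eq_true_eq, Subtype.mk.injEq] at hX
    have haX : a' ∈ Subtype.val ⁻¹' X.1 := hX.2 ▸ Set.mem_singleton a'
    exact X.2 hX.1 haX hva.ne hva
  have := Fintype.ofFinite (indepSets G)
  have := Fintype.ofFinite (indepSets (G.induce {v}ᶜ))
  simpa [Nat.card_eq_fintype_card] using Fintype.card_lt_of_injective_of_notMem f hf hmissed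

theorem card_add_two_le_card_indepSets [Finite V] {a b : V} (hab : a ≠ b) (hadj : ¬ G.Adj a b) :
    Nat.card V + 2 ≤ Nat.card (indepSets G) := by
  have hsub : insert ∅ (insert {a, b} (Set.range singleton)) ⊆ indepSets G := by
    rintro X (rfl | rfl | ⟨x, rfl⟩)
    · exact mem_indepSets_of_subsingleton G Set.subsingleton_empty
    · exact pair_mem_indepSets hadj
    · exact mem_indepSets_of_subsingleton G Set.subsingleton_singleton
  have hpair : ({a, b} : Set V) ∉ Set.range singleton := by
    rintro ⟨x, hx⟩
    exact hab ((Set.eq_of_mem_singleton (hx ▸ Set.mem_insert a {b})).trans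
      (Set.eq_of_mem_singleton (hx ▸ Set.mem_insert_of_mem a (Set.mem_singleton b))).symm)
  have hempty : (∅ : Set V) ∉ insert {a, b} (Set.range singleton) := by
    rintro (h | ⟨x, hx⟩)
    · exact (Set.insert_nonempty a {b}).ne_empty h.symm
    · exact Set.singleton_ne_empty x hx
  rw [Nat.card_coe_set_eq, ← Set.ncard_range_of_injective Set.singleton_injective]
  refine le_of_eq_of_le ?_ (Set.ncard_le_ncard hsub)
  rw [Set.ncard_insert_of_notMem hempty, Set.ncard_insert_of_notMem hpair]

theorem three_le_card_of_not_adj [Finite V] (hG : G.Connected) {a b : V} (hab : a ≠ b)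
    (hadj : ¬ G.Adj a b) : 3 ≤ Nat.card V := by
  have : Nontrivial V := ⟨a, b, hab⟩
  obtain ⟨c, hac⟩ := hG.preconnected.exists_adj_of_nontrivial a
  have hbc : b ≠ c := by
    rintro rfl
    exact hadj hac
  have := Fintype.ofFinite V
  rw [Nat.card_eq_fintype_card]
  exact Fintype.two_lt_card_iff.2 ⟨a, b, c, hab, hac.ne, hbc⟩

theorem connected_induction {motive : ∀ (V : Type u) [Finite V], SimpleGraph V → Prop}
    (subsingleton : ∀ (V : Type u) [Finite V] [Nonempty V] [Subsingleton V] (G : SimpleGraph V),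
      motive V G)
    (delete_vertex : ∀ (V : Type u) [Finite V] [Nontrivial V] (G : SimpleGraph V) (v : V),
      G.Connected → (G.induce {v}ᶜ).Connected → motive ({v}ᶜ : Set V) (G.induce {v}ᶜ) → motive V G)
    {V : Type u} [Finite V] {G : SimpleGraph V} (hG : G.Connected) : motive V G := by
  induction hn : Nat.card V using Nat.strong_induction_on generalizing V with
  | _ n ih =>
  have := hG.nonempty
  rcases subsingleton_or_nontrivial V with _ | _
  · exact subsingleton V G
  · obtain ⟨v, hv⟩ := hG.exists_connected_induce_compl_singleton_of_finite_nontrivial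
    have hcard : Nat.card ({v}ᶜ : Set V) < n := by
      rw [← hn, Nat.card_coe_set_eq, ← Set.ncard_univ]
      exact Set.ncard_lt_ncard (Set.ssubset_univ_iff.2 (by simp))
    exact delete_vertex V G v hG hv (ih _ hcard hv rfl)

theorem isPreprimitive_toggleGroup_indepSets [Finite V] (hG : G.Connected) :
    IsPreprimitive (toggleGroup (indepSets G)) (indepSets G) := by
  refine connected_induction
    (motive := fun V _ G => IsPreprimitive (toggleGroup (indepSets G)) (indepSets G)) ?_ ?_ hG
  · intro V _ _ _ G
    have := isPretransitive_toggleGroup_indepSets G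
    refine IsPreprimitive.of_prime_card ?_
    have huniv : indepSets G = Set.univ :=
      Set.eq_univ_of_forall fun X => mem_indepSets_of_subsingleton G X.subsingleton_of_subsingleton
    have hcard : Nat.card V = 1 := Nat.card_eq_one_iff_unique.2 ⟨inferInstance, inferInstance⟩
    have htwo : Nat.card (indepSets G) = 2 := by
      have := Fintype.ofFinite V
      rw [huniv, Nat.card_coe_set_eq, Set.ncard_univ, Nat.card_eq_fintype_card, Fintype.card_set,
        ← Nat.card_eq_fintype_card, hcard, pow_one]
    exact htwo ▸ Nat.prime_two
  · intro V _ _ G v hG _ ih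
    have := isPretransitive_toggleGroup_indepSets G
    obtain ⟨a, hva⟩ := hG.preconnected.exists_adj_of_nontrivial v
    exact isPreprimitive_toggleGroup_of_semiconj (indepSetsEmbedding G _).injective
      (semiconj_indepSetsEmbedding_toggle G _) (card_indepSets_lt hva)

theorem eq_singleton_of_mem_indepSets {a : V} (ha : G.IsUniversal a) {X : Set V}
    (hX : X ∈ indepSets G) (haX : a ∈ X) : X = {a} :=
  Set.eq_singleton_iff_unique_mem.2 ⟨haX, fun _ hb => by_contra fun hba =>
    hX haX hb (Ne.symm hba) (ha (Ne.symm hba))⟩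

theorem isSwap_toggle_indepSets [DecidableEq (indepSets G)] {a : V}
    (ha : G.IsUniversal a) : (toggle (indepSets G) a).IsSwap := by
  let O : indepSets G := ⟨∅, mem_indepSets_of_subsingleton G Set.subsingleton_empty⟩
  let A : indepSets G := ⟨{a}, mem_indepSets_of_subsingleton G Set.subsingleton_singleton⟩
  have hOA : O ≠ A := fun h => Set.singleton_ne_empty a (congrArg Subtype.val h).symm
  have hO : O.1 ∆ {a} = A.1 := bot_symmDiff _
  have hA : A.1 ∆ {a} = O.1 := symmDiff_self _
  refine ⟨O, A, hOA, Equiv.ext fun X => ?_⟩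
  by_cases hXO : X = O
  · rw [hXO, Equiv.swap_apply_left, toggle_apply_of_mem (by rw [hO]; exact A.2)]
    exact Subtype.ext hO
  by_cases hXA : X = A
  · rw [hXA, Equiv.swap_apply_right, toggle_apply_of_mem (by rw [hA]; exact O.2)]
    exact Subtype.ext hA
  rw [Equiv.swap_apply_of_ne_of_ne hXO hXA]
  refine toggle_apply_of_notMem fun hX => ?_
  by_cases haX : a ∈ X.1
  · exact hXA (Subtype.ext (eq_singleton_of_mem_indepSets ha X.2 haX))
  · have hXa : X.1 ∆ {a} = {a} := eq_singleton_of_mem_indepSets ha hX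
      (Or.inr ⟨Set.mem_singleton a, haX⟩)
    exact hXO (Subtype.ext (symmDiff_eq_right.1 hXa))

theorem toggleGroup_indepSets_eq_top [Finite V] {a : V} (ha : G.IsUniversal a) :
    toggleGroup (indepSets G) = ⊤ := by
  classical
  exact Equiv.Perm.subgroup_eq_top_of_isPreprimitive_of_isSwap_mem
    (isPreprimitive_toggleGroup_indepSets (.of_isUniversal ha)) _ (isSwap_toggle_indepSets ha)
    (toggle_mem_toggleGroup _ a)

theorem ToggleAlternating.of_induce_compl_singleton [Finite V] {v a b : V}
    (hG : G.Connected) (hv : (G.induce {v}ᶜ).Connected) (hva : G.Adj v a) (hab : a ≠ b)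
    (hadj : ¬ G.Adj a b) (h : ToggleAlternating (indepSets (G.induce {v}ᶜ))) :
    ToggleAlternating (indepSets G) := by
  classical
  have hbv : b ≠ v := by
    rintro rfl
    exact hadj hva.symm
  have hab' : (⟨a, hva.ne'⟩ : ({v}ᶜ : Set V)) ≠ ⟨b, hbv⟩ := fun h => hab (congrArg Subtype.val h)
  have hfive : 5 ≤ Nat.card (indepSets (G.induce {v}ᶜ)) := by
    have hthree := three_le_card_of_not_adj hv hab' hadj
    have := card_add_two_le_card_indepSets (G := G.induce {v}ᶜ) hab' hadj
    lia
  have := isPreprimitive_toggleGroup_indepSets hG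
  let _ : Fintype (indepSets G) := Fintype.ofFinite _
  let _ : Fintype (indepSets (G.induce {v}ᶜ)) := Fintype.ofFinite _
  exact alternatingGroup_le_of_isPreprimitive_of_semiconj hfive (card_indepSets_lt hva)
    fun σ hσ => exists_mem_toggleGroup_semiconj (semiconj_indepSetsEmbedding_toggle G _) (h hσ)

theorem toggleAlternating_indepSets [Finite V] (hG : G.Connected) :
    ToggleAlternating (indepSets G) := by
  refine connected_induction (motive := fun V _ G => ToggleAlternating (indepSets G)) ?_ ?_ hG
  · intro V _ hV _ G
    exact .of_toggleGroup_eq_top (toggleGroup_indepSets_eq_top (a := hV.some) .of_subsingleton)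
  · intro V _ _ G v hG hv ih
    obtain ⟨a, hva⟩ := hG.preconnected.exists_adj_of_nontrivial v
    by_cases ha : G.IsUniversal a
    · exact .of_toggleGroup_eq_top (toggleGroup_indepSets_eq_top ha)
    · simp only [SimpleGraph.IsUniversal, not_forall] at ha
      obtain ⟨b, hab, hadj⟩ := ha
      exact ih.of_induce_compl_singleton hG hv hva hab hadj

end IndependentSets

section OrdinalSums

variable {P P₁ P₂ : Type*} [PartialOrder P] [PartialOrder P₁] [PartialOrder P₂]

/-- The incomparability graph of a poset, whose independent sets are the chains of the poset. -/
def incompGraph (P : Type*) [PartialOrder P] : SimpleGraph P where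
  Adj a b := IncompRel (· ≤ ·) a b
  symm := ⟨fun _ _ h => h.symm⟩
  loopless := ⟨fun _ h => h.1 le_rfl⟩

theorem chains_eq_indepSets (P : Type*) [PartialOrder P] :
    chains P = indepSets (incompGraph P) := by
  ext C
  simp only [chains, IsChain, indepSets, SimpleGraph.isIndepSet_iff, incompGraph,
    Set.mem_ofPred_eq, IncompRel, not_and_or, not_not]

theorem lt_or_gt_of_not_reachable {a b : P} (hab : ¬ (incompGraph P).Reachable a b) :
    a < b ∨ b < a := by
  rcases lt_or_eq_or_gt_or_incompRel a b with h | rfl | h | h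
  · exact Or.inl h
  · exact absurd (SimpleGraph.Reachable.refl a) hab
  · exact Or.inr h
  · exact absurd (SimpleGraph.Adj.reachable (G := incompGraph P) h) hab

theorem lt_of_lt_of_reachable {a b c : P} (hbc : (incompGraph P).Reachable b c)
    (hab : ¬ (incompGraph P).Reachable a b) (h : a < b) : a < c := by
  rw [SimpleGraph.reachable_iff_reflTransGen] at hbc
  induction hbc with
  | refl => exact h
  | @tail c d hbc hcd ih =>
    have hbd := (SimpleGraph.reachable_iff_reflTransGen b d).2 (hbc.tail hcd)
    refine (lt_or_gt_of_not_reachable fun had => hab (had.trans hbd.symm)).resolve_right ?_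
    exact fun hda => hcd.2 (hda.trans ih).le

/-- A subset all of whose elements lie below its complement splits the poset as an ordinal sum. -/
noncomputable def sumLexComplOrderIso (S : Set P) (hS : ∀ a ∈ S, ∀ b ∉ S, a < b) :
    P ≃o S ⊕ₗ (Sᶜ : Set P) :=
  open Classical in
  OrderIso.symm
    { toEquiv := ofLex.trans (Equiv.Set.sumCompl S)
      map_rel_iff' := by
        intro x y
        induction x using Lex.rec with | _ x =>
        induction y using Lex.rec with | _ y =>
        rcases x with x | x <;> rcases y with y | y
        · simp
        · simpa using (hS x.1 x.2 y.1 y.2).le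
        · simpa using not_le_of_gt (hS y.1 y.2 x.1 x.2)
        · simp }

theorem preconnected_incompGraph (hP : ¬ IsOrdinalSum P) : (incompGraph P).Preconnected := by
  by_contra hG
  obtain ⟨a, b, hab, hlt⟩ : ∃ a b, ¬ (incompGraph P).Reachable a b ∧ a < b := by
    simp only [SimpleGraph.Preconnected, not_forall] at hG
    obtain ⟨a, b, hab⟩ := hG
    rcases lt_or_gt_of_not_reachable hab with h | h
    · exact ⟨a, b, hab, h⟩
    · exact ⟨b, a, fun hba => hab hba.symm, h⟩
  let S : Set P := {x | x < b ∧ ¬ (incompGraph P).Reachable x b}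
  refine hP ⟨S, (Sᶜ : Set P), inferInstance, inferInstance, ⟨a, hlt, hab⟩,
    ⟨b, fun hb => hb.1.false⟩, ⟨sumLexComplOrderIso S ?_⟩⟩
  rintro x ⟨hxb, hxr⟩ y hy
  by_cases hyr : (incompGraph P).Reachable y b
  · exact lt_of_lt_of_reachable hyr.symm hxr hxb
  · exact hxb.trans ((lt_or_gt_of_not_reachable hyr).resolve_left fun hyb => hy ⟨hyb, hyr⟩)

theorem toggleAlternating_chains [Finite P] (hP : ¬ IsOrdinalSum P) :
    ToggleAlternating (chains P) := by
  rw [chains_eq_indepSets]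
  cases isEmpty_or_nonempty P
  · exact .of_toggleGroup_eq_top (Subsingleton.elim _ _)
  · exact toggleAlternating_indepSets ⟨preconnected_incompGraph hP⟩

theorem isDirectSum_chains (e : P₁ ⊕ₗ P₂ ≃o P) :
    IsDirectSum (toLex.trans e.toEquiv) (chains P₁) (chains P₂) (chains P) := by
  rintro ⟨C₁, C₂⟩
  rw [unionEquiv_apply]
  constructor
  · intro h
    refine ⟨fun x hx y hy hxy => ?_, fun x hx y hy hxy => ?_⟩
    · simpa using h (Or.inl ⟨x, hx, rfl⟩) (Or.inl ⟨y, hy, rfl⟩) (by simpa using hxy)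
    · simpa using h (Or.inr ⟨x, hx, rfl⟩) (Or.inr ⟨y, hy, rfl⟩) (by simpa using hxy)
  · rintro ⟨h₁, h₂⟩ _ (⟨x, hx, rfl⟩ | ⟨x, hx, rfl⟩) _ (⟨y, hy, rfl⟩ | ⟨y, hy, rfl⟩) hxy
    · simpa using h₁ hx hy (fun h => hxy (h ▸ rfl))
    · exact Or.inl (by simp)
    · exact Or.inr (by simp)
    · simpa using h₂ hx hy (fun h => hxy (h ▸ rfl))

end OrdinalSums

end ToggleGroups

theorem mainTheorem4_general {P : Type*} [PartialOrder P] :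
    (∀ {P₁ P₂ : Type*} [PartialOrder P₁] [PartialOrder P₂] (e : P ≃o P₁ ⊕ₗ P₂),
      ∃ (b : ToggleGroups.chains P₁ × ToggleGroups.chains P₂ ≃ ToggleGroups.chains P)
        (φ : ToggleGroups.toggleGroup (ToggleGroups.chains P) ≃*
          ToggleGroups.toggleGroup (ToggleGroups.chains P₁) ×
            ToggleGroups.toggleGroup (ToggleGroups.chains P₂)),
        (∀ (C₁ : ToggleGroups.chains P₁) (C₂ : ToggleGroups.chains P₂),
          (b (C₁, C₂)).1 =
            (fun p => e.symm (Sum.inlₗ p)) '' C₁.1 ∪ (fun p => e.symm (Sum.inrₗ p)) '' C₂.1) ∧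
        (∀ (g : ToggleGroups.toggleGroup (ToggleGroups.chains P))
          (C₁ : ToggleGroups.chains P₁) (C₂ : ToggleGroups.chains P₂),
          g.1 (b (C₁, C₂)) = b ((φ g).1.1 C₁, (φ g).2.1 C₂))) ∧
    (∀ [Finite P], ¬ ToggleGroups.IsOrdinalSum P →
      ToggleGroups.ToggleAlternating (ToggleGroups.chains P)) := by
  refine ⟨fun {P₁ P₂} _ _ e => ?_, ToggleGroups.toggleAlternating_chains⟩
  have h := ToggleGroups.isDirectSum_chains e.symm
  have : Nonempty (ToggleGroups.chains P₁) := ⟨⟨∅, IsChain.empty⟩⟩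
  have : Nonempty (ToggleGroups.chains P₂) := ⟨⟨∅, IsChain.empty⟩⟩
  refine ⟨h.prodEquiv, h.toggleGroupProdEquiv.symm, fun C₁ C₂ => h.coe_prodEquiv (C₁, C₂),
    fun g C₁ C₂ => ?_⟩
  rw [← h.toggleGroupProdEquiv_apply _ (C₁, C₂), MulEquiv.apply_symm_apply]

/-- For a finite poset `P`:
* if `e` identifies `P` with the ordinal sum `P₁ ⊕ₗ P₂`, then `(C₁, C₂) ↦ C₁ ∪ C₂` is a bijection
  `b` from pairs of chains to chains of `P`, and, through `b`, the toggle group of the chains of `P`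
  is the direct product of those of `P₁` and `P₂`, acting componentwise;
* if `P` is not an ordinal sum of two nonempty posets, its chain family is toggle-alternating. -/
theorem mainTheorem4 {P : Type*} [PartialOrder P] [Finite P] :
    (∀ {P₁ P₂ : Type*} [PartialOrder P₁] [PartialOrder P₂] (e : P ≃o P₁ ⊕ₗ P₂),
      ∃ (b : ToggleGroups.chains P₁ × ToggleGroups.chains P₂ ≃ ToggleGroups.chains P)
        (φ : ToggleGroups.toggleGroup (ToggleGroups.chains P) ≃*
          ToggleGroups.toggleGroup (ToggleGroups.chains P₁) ×
            ToggleGroups.toggleGroup (ToggleGroups.chains P₂)),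
        (∀ (C₁ : ToggleGroups.chains P₁) (C₂ : ToggleGroups.chains P₂),
          (b (C₁, C₂)).1 =
            (fun p => e.symm (Sum.inlₗ p)) '' C₁.1 ∪ (fun p => e.symm (Sum.inrₗ p)) '' C₂.1) ∧
        (∀ (g : ToggleGroups.toggleGroup (ToggleGroups.chains P))
          (C₁ : ToggleGroups.chains P₁) (C₂ : ToggleGroups.chains P₂),
          g.1 (b (C₁, C₂)) = b ((φ g).1.1 C₁, (φ g).2.1 C₂))) ∧
    (¬ ToggleGroups.IsOrdinalSum P →
      ToggleGroups.ToggleAlternating (ToggleGroups.chains P)) := by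
  obtain ⟨hsum, hindec⟩ := mainTheorem4_general (P := P)
  exact ⟨hsum, hindec⟩
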